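/- All graphs are finite, simple and undirected; formulas are first-order formulas over the signature consisting of adjacency $E$ and equality. For sets $A,B,S\subseteq V(G)$ and $r\in\mathbb N$, the sets $A$ and $B$ are *$r$-separated* by $S$ in $G$ if every path of length at most $r$ from a vertex of $A$ to a vertex of $B$ (including paths of length $0$) contains a vertex of $S$. For a formula $\varphi(\bar x,\bar y)$ with its free variables partitioned into $\bar x$ and $\bar y$, the $\varphi$-type over $B$ of a tuple $\bar u\in V(G)^{|\bar x|}$ is $\mathrm{tp}^{\varphi}_G(\bar u/B)=\{\bar v\in B^{|\bar y|} : G\models\varphi(\bar u,\bar v)\}$, and $S^{\varphi}(A/B)=\{\mathrm{tp}^{\varphi}_G(\bar u/B) : \bar u\in A^{|\bar x|}\}$. For $q\in\mathbb N$ and $\bar u\in V(G)^d$, $\mathrm{tp}^q_G(\bar u/B)$ is the set of all formulas with parameters $\varphi(\bar x,\bar v)$ such that $\varphi(\bar x,\bar y)$ has quantifier rank at most $q$, $|\bar x|=d$, $|\bar y|$ is arbitrary, $\bar v\in B^{|\bar y|}$, and $G\models\varphi(\bar u,\bar v)$. Then the following hold. 1. There are computable functions $p,r\colon\mathbb N^2\to\mathbb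 N$ such that for all $q,d\in\mathbb N$, every graph $G$ and all $A,B,S\subseteq V(G)$ such that $A$ and $B$ are $r(q,d)$-separated by $S$ in $G$: for all $\bar u,\bar u'\in A^d$, if $\mathrm{tp}^{p(q,d)}_G(\bar u/S)=\mathrm{tp}^{p(q,d)}_G(\bar u'/S)$, then $\mathrm{tp}^{q}_G(\bar u/B)=\mathrm{tp}^{q}_G(\bar u'/B)$. 2. There are a number $r=r(\varphi)$, computable from the partitioned formula $\varphi(\bar x,\bar y)$, and a number $T=T(\varphi,s)$, computable from $\varphi(\bar x,\bar y)$ and $s\in\mathbb N$, such that for every formula $\varphi(\bar x,\bar y)$, every $s\in\mathbb N$, every graph $G$ and all $A,B,S\subseteq V(G)$ with $|S|\le s$ such that $A$ and $B$ are $r(\varphi)$-separated by $S$ in $G$, we have $|S^{\varphi}(A/B)|\le T(\varphi,s)$. -/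

import Mathlib

open FirstOrder

namespace GraphTypes

/-- First-order formulas `φ(x̄, ȳ)` on graphs, with `|x̄| = d` object variables and `|ȳ| = l`
parameter variables. -/
abbrev Fml (d l : ℕ) : Type := Language.graph.Formula (Fin d ⊕ Fin l)

/-- Quantifier rank: the nesting depth of quantifiers (`∃` is `¬ ∀ ¬`). -/
def qrank {α : Type} : {n : ℕ} → Language.graph.BoundedFormula α n → ℕ
  | _, .falsum => 0
  | _, .equal _ _ => 0
  | _, .rel _ _ => 0
  | _, .imp φ ψ => max (qrank φ) (qrank ψ)
  | _, .all φ => qrank φ + 1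

/-- Code of a variable (the language of graphs has no function symbols). -/
def termCode {d l n : ℕ} : Language.graph.Term ((Fin d ⊕ Fin l) ⊕ Fin n) → ℕ
  | .var (.inl (.inl i)) => 3 * (i : ℕ)
  | .var (.inl (.inr j)) => 3 * (j : ℕ) + 1
  | .var (.inr k) => 3 * (k : ℕ) + 2
  | .func f _ => Empty.elim f

/-- Code of an atomic formula `R(ts)`; the only relation symbol is adjacency. -/
def relCode {d l n : ℕ} : {k : ℕ} → Language.graph.Relations k →
    (Fin k → Language.graph.Term ((Fin d ⊕ Fin l) ⊕ Fin n)) → ℕ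
  | _, Language.graphRel.adj, ts => Nat.pair (termCode (ts 0)) (termCode (ts 1))

/-- Gödel numbering of formulas whose free variables are `x₀, …, x_{d-1}, y₀, …, y_{l-1}` and
which have `n` further variables available for binding. -/
def bdCode {d l : ℕ} : {n : ℕ} → Language.graph.BoundedFormula (Fin d ⊕ Fin l) n → ℕ
  | _, .falsum => 0
  | _, .equal t t' => 4 * Nat.pair (termCode t) (termCode t') + 1
  | _, .rel R ts => 4 * relCode R ts + 2
  | _, .imp φ ψ => 4 * Nat.pair (bdCode φ) (bdCode ψ) + 3
  | _, .all φ => 4 * bdCode φ + 4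

/-- The Gödel number of `φ(x̄, ȳ)`, recording also the partition of the variables. -/
def code {d l : ℕ} (φ : Fml d l) : ℕ :=
  Nat.pair d (Nat.pair l (bdCode φ))

theorem termCode_injective {d l n : ℕ} :
    Function.Injective (termCode (d := d) (l := l) (n := n)) := by
  intro t t' h
  rcases t with ((i | i) | i) | ⟨f, _⟩ <;> rcases t' with ((j | j) | j) | ⟨g, _⟩ <;>
    first
      | exact Empty.elim f
      | exact Empty.elim g
      | (simp only [termCode] at h
         first
           | (exfalso; omega)
           | (have hij : i = j := Fin.ext (by omega)
              rw [hij]))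

theorem bdCode_injective {d l n : ℕ} :
    Function.Injective (bdCode (d := d) (l := l) (n := n)) := by
  have key : ∀ {a b c : ℕ}, 4 * a + c = 4 * b + c → a = b := by intros; omega
  intro φ
  induction φ with
  | falsum => intro ψ h; cases ψ <;> simp only [bdCode] at h <;> first | rfl | omega
  | equal t t' =>
    intro ψ h
    cases ψ <;> simp only [bdCode] at h <;> first | omega | skip
    obtain ⟨h1, h2⟩ := Nat.pair_eq_pair.1 (key h)
    rw [termCode_injective h1, termCode_injective h2]
  | rel R ts =>
    intro ψ h
    cases ψ <;> simp only [bdCode] at h <;> first | omega | skip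
    rename_i R' ts'
    cases R; cases R'
    obtain ⟨h1, h2⟩ := Nat.pair_eq_pair.1 (key h)
    congr 1
    funext i
    fin_cases i
    · exact termCode_injective h1
    · exact termCode_injective h2
  | imp φ₁ φ₂ ih₁ ih₂ =>
    intro ψ h
    cases ψ <;> simp only [bdCode] at h <;> first | omega | skip
    obtain ⟨h1, h2⟩ := Nat.pair_eq_pair.1 (key h)
    rw [ih₁ h1, ih₂ h2]
  | all φ ih =>
    intro ψ h
    cases ψ <;> simp only [bdCode] at h <;> first | omega | skip
    rw [ih (key h)]

/-- `G, ū v̄ ⊨ φ(x̄, ȳ)`. -/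
def Sat {V : Type*} (G : SimpleGraph V) {d l : ℕ} (φ : Fml d l) (u : Fin d → V)
    (v : Fin l → V) : Prop :=
  @Language.Formula.Realize _ V G.structure _ φ (Sum.elim u v)

/-- The `φ`-type of `ū` over `B`, as the set of parameter tuples `v̄` from `B` for which
`φ(ū, v̄)` holds. -/
def phiType {V : Type*} (G : SimpleGraph V) {d l : ℕ} (φ : Fml d l) (B : Set V)
    (u : Fin d → V) : Set (Fin l → V) :=
  {v | (∀ j, v j ∈ B) ∧ Sat G φ u v}

/-- The set `S^φ(A/B)` of all `φ`-types over `B` of tuples from `A`. -/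
def typeSet {V : Type*} (G : SimpleGraph V) {d l : ℕ} (φ : Fml d l) (A B : Set V) :
    Set (Set (Fin l → V)) :=
  {τ | ∃ u : Fin d → V, (∀ i, u i ∈ A) ∧ phiType G φ B u = τ}

/-- The type `tp^q(ū/B)`: the set of all formulas with parameters `φ(x̄, v̄)`, where `φ(x̄, ȳ)` has
quantifier rank at most `q` (and `ȳ` any length) and `v̄` is a tuple from `B`, that `ū` satisfies
in `G`. -/
def rankType {V : Type*} (G : SimpleGraph V) (q : ℕ) {d : ℕ} (B : Set V) (u : Fin d → V) :
    Set (Σ l : ℕ, Fml d l × (Fin l → V)) :=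
  {θ | qrank θ.2.1 ≤ q ∧ (∀ j, θ.2.2 j ∈ B) ∧ Sat G θ.2.1 u θ.2.2}

/-- `A` and `B` are `r`-separated by `S` in `G`: every path of length at most `r` from a vertex
of `A` to a vertex of `B` contains a vertex of `S`. -/
def Separated {V : Type*} (G : SimpleGraph V) (r : ℕ) (A B S : Set V) : Prop :=
  ∀ a ∈ A, ∀ b ∈ B, ∀ w : G.Walk a b, w.IsPath → w.length ≤ r → ∃ v ∈ w.support, v ∈ S

end GraphTypes

/-! Types are compared through Ehrenfeucht–Fraïssé games whose positions are sets of pairs of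
vertices. Equal rank-`sepRank` types over `S` give a winning position containing `diag S`
(`graphGame_of_rankType_eq`). Delete the edges meeting `S` and let colours remember equality and
adjacency with members of `S`: the game on `G` becomes a game on a coloured graph `H`, where
vertices of `A` outside `S` are far from `B ∪ S` (`Separated.not_near`).

In `H` a Gaifman-style locality argument applies. A long unrestricted game preserves distances, so
it yields a strategy for the game confined to bounded neighbourhoods of the position
(`FullGame.localGame`). Conversely, `LocalGame.fullGame` turns a local strategy on the few pairs
from `A` outside `S` into an unrestricted one fixing all of `B ∪ S`: moves near the fixed set are
copied, moves near the pairs use the local strategy, and other moves are answered by a locally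
equivalent vertex far from the pairs. That such a vertex exists is the pigeonhole argument of
`LocalGame.exists_far`. Translating back to `G` gives `GraphGame.of_separated`, hence the first
claim.

For the second claim, list `S` as a tuple and append it to the tuple from `A`. The game equivalence
class of the result determines the `φ`-type over `B`, and the number of classes is bounded by
`tower` (`exists_classifier`). -/

namespace GraphTypes

/-! ### Back-and-forth games. -/

/-- The back-and-forth game on positions `R : Set (V × V)`: all positions satisfy `At`, and the
first player may only play in the set `N X`, where `X` is the current position on their side. -/
def BackForth {V : Type*} (At : Set (V × V) → Prop) (N : Set V → Set V) :
    ℕ → Set (V × V) → Prop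
  | 0, R => At R
  | k + 1, R => At R ∧
      (∀ w ∈ N (Prod.fst '' R), ∃ w', BackForth At N k (insert (w, w') R)) ∧
      (∀ w' ∈ N (Prod.snd '' R), ∃ w, BackForth At N k (insert (w, w') R))

namespace BackForth

variable {V : Type*} {At At' : Set (V × V) → Prop} {N N' : Set V → Set V}

theorem atoms {k : ℕ} {R : Set (V × V)} (h : BackForth At N k R) : At R := by
  cases k with
  | zero => exact h
  | succ k => exact h.1

theorem swap_insert (w w' : V) (R : Set (V × V)) :
    Prod.swap ⁻¹' (insert (w, w') R) = insert (w', w) (Prod.swap ⁻¹' R) := by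
  ext ⟨a, b⟩
  simp [and_comm]

theorem fst_swap (R : Set (V × V)) : Prod.fst '' (Prod.swap ⁻¹' R) = Prod.snd '' R := by
  ext a; simp

theorem snd_swap (R : Set (V × V)) : Prod.snd '' (Prod.swap ⁻¹' R) = Prod.fst '' R := by
  ext a; simp

theorem swap_swap (R : Set (V × V)) : Prod.swap ⁻¹' (Prod.swap ⁻¹' R) = R := by
  ext ⟨a, b⟩; simp

/-- A symmetric invariant that the second player can maintain yields a winning strategy. -/
theorem of_invariant (Φ : ℕ → Set (V × V) → Prop)
    (hsymm : ∀ k R, Φ k R → Φ k (Prod.swap ⁻¹' R)) (hAt : ∀ k R, Φ k R → At R)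
    (hstep : ∀ k R, Φ (k + 1) R → ∀ w ∈ N (Prod.fst '' R), ∃ w', Φ k (insert (w, w') R))
    {k : ℕ} {R : Set (V × V)} (h : Φ k R) : BackForth At N k R := by
  induction k generalizing R with
  | zero => exact hAt _ _ h
  | succ k ih =>
    refine ⟨hAt _ _ h, fun w hw => ?_, fun w' hw' => ?_⟩
    · obtain ⟨w', h'⟩ := hstep _ _ h w hw
      exact ⟨w', ih h'⟩
    · rw [← fst_swap] at hw'
      obtain ⟨w, h'⟩ := hstep _ _ (hsymm _ _ h) w' hw'
      refine ⟨w, ih ?_⟩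
      have := hsymm _ _ h'
      rwa [swap_insert, swap_swap] at this

theorem symm (hAt : ∀ R, At R → At (Prod.swap ⁻¹' R)) {k : ℕ} {R : Set (V × V)}
    (h : BackForth At N k R) : BackForth At N k (Prod.swap ⁻¹' R) := by
  induction k generalizing R with
  | zero => exact hAt _ h
  | succ k ih =>
    refine ⟨hAt _ h.1, fun w hw => ?_, fun w hw => ?_⟩
    · rw [fst_swap] at hw
      obtain ⟨w', h'⟩ := h.2.2 w hw
      exact ⟨w', by simpa only [swap_insert] using ih h'⟩
    · rw [snd_swap] at hw
      obtain ⟨w', h'⟩ := h.2.1 w hw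
      exact ⟨w', by simpa only [swap_insert] using ih h'⟩

theorem of_succ {k : ℕ} {R : Set (V × V)} (h : BackForth At N (k + 1) R) :
    BackForth At N k R := by
  induction k generalizing R with
  | zero => exact h.1
  | succ k ih =>
    refine ⟨h.1, fun w hw => ?_, fun w hw => ?_⟩
    · obtain ⟨w', h'⟩ := h.2.1 w hw
      exact ⟨w', ih h'⟩
    · obtain ⟨w', h'⟩ := h.2.2 w hw
      exact ⟨w', ih h'⟩

theorem of_le {k k' : ℕ} (hk : k ≤ k') {R : Set (V × V)} (h : BackForth At N k' R) :
    BackForth At N k R := by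
  induction hk with
  | refl => exact h
  | step _ ih => exact ih h.of_succ

/-- Positions only grow during play, so the two atomic conditions need comparing only above `R₀`;
this is used with an `R₀` that contains `diag S`. -/
theorem imp {R₀ : Set (V × V)} (hAt : ∀ R, R₀ ⊆ R → At R → At' R) (hN : ∀ X, N' X ⊆ N X)
    {k : ℕ} {R : Set (V × V)} (hR : R₀ ⊆ R) (h : BackForth At N k R) :
    BackForth At' N' k R := by
  induction k generalizing R with
  | zero => exact hAt _ hR h
  | succ k ih =>
    refine ⟨hAt _ hR h.1, fun w hw => ?_, fun w hw => ?_⟩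
    · obtain ⟨w', h'⟩ := h.2.1 w (hN _ hw)
      exact ⟨w', ih (hR.trans (Set.subset_insert _ _)) h'⟩
    · obtain ⟨w', h'⟩ := h.2.2 w (hN _ hw)
      exact ⟨w', ih (hR.trans (Set.subset_insert _ _)) h'⟩

theorem subset (hAt : ∀ R R', R ⊆ R' → At R' → At R) (hN : Monotone N)
    {k : ℕ} {R R' : Set (V × V)} (hR : R ⊆ R') (h : BackForth At N k R') :
    BackForth At N k R := by
  induction k generalizing R R' with
  | zero => exact hAt _ _ hR h
  | succ k ih =>
    refine ⟨hAt _ _ hR h.1, fun w hw => ?_, fun w hw => ?_⟩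
    · obtain ⟨w', h'⟩ := h.2.1 w (hN (Set.image_mono hR) hw)
      exact ⟨w', ih (Set.insert_subset_insert hR) h'⟩
    · obtain ⟨w', h'⟩ := h.2.2 w (hN (Set.image_mono hR) hw)
      exact ⟨w', ih (Set.insert_subset_insert hR) h'⟩

end BackForth

/-! ### Local and unrestricted games on a coloured graph. -/

/-- Distance at most `n`. -/
def Near {V : Type*} (H : SimpleGraph V) (n : ℕ) (x y : V) : Prop :=
  ∃ w : H.Walk x y, w.length ≤ n

namespace Near

variable {V : Type*} {H : SimpleGraph V} {m n : ℕ} {x y z : V}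

theorem refl (H : SimpleGraph V) (n : ℕ) (x : V) : Near H n x x := ⟨.nil, Nat.zero_le _⟩

theorem symm (h : Near H n x y) : Near H n y x :=
  h.imp' SimpleGraph.Walk.reverse fun w hw => by simpa using hw

theorem comm : Near H n x y ↔ Near H n y x := ⟨symm, symm⟩

theorem mono (hmn : m ≤ n) (h : Near H m x y) : Near H n x y :=
  h.imp fun _ hw => hw.trans hmn

theorem trans (h : Near H m x y) (h' : Near H n y z) : Near H (m + n) x z := by
  obtain ⟨w, hw⟩ := h
  obtain ⟨w', hw'⟩ := h'
  exact ⟨w.append w', by rw [SimpleGraph.Walk.length_append]; omega⟩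

theorem zero_iff : Near H 0 x y ↔ x = y := by
  constructor
  · rintro ⟨w, hw⟩
    exact SimpleGraph.Walk.eq_of_length_eq_zero (Nat.le_zero.1 hw)
  · rintro rfl
    exact refl _ _ _

theorem one_iff : Near H 1 x y ↔ x = y ∨ H.Adj x y := by
  constructor
  · rintro ⟨w, hw⟩
    rcases Nat.le_one_iff_eq_zero_or_eq_one.1 hw with h | h
    · exact .inl (SimpleGraph.Walk.eq_of_length_eq_zero h)
    · exact .inr (SimpleGraph.Walk.adj_of_length_eq_one h)
  · rintro (rfl | h)
    · exact refl _ _ _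
    · exact ⟨h.toWalk, by simp⟩

theorem split (h : Near H (n + 1) x y) : ∃ z, Near H 1 x z ∧ Near H n z y := by
  obtain ⟨w, hw⟩ := h
  cases w with
  | nil => exact ⟨x, refl _ _ _, refl _ _ _⟩
  | cons h w => exact ⟨_, one_iff.2 (.inr h), w, by simpa using hw⟩

end Near

/-- The position `R` preserves the colouring `c` and all distances up to `n`. -/
def ColAtoms {V C : Type*} (c : V → C) (H : SimpleGraph V) (n : ℕ) (R : Set (V × V)) : Prop :=
  (∀ p ∈ R, c p.1 = c p.2) ∧
    ∀ p ∈ R, ∀ q ∈ R, ∀ j ≤ n, (Near H j p.1 q.1 ↔ Near H j p.2 q.2)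

/-- The vertices at distance at most `n` from `X`. -/
def nbhd {V : Type*} (H : SimpleGraph V) (n : ℕ) (X : Set V) : Set V :=
  {w | ∃ x ∈ X, Near H n x w}

/-- The game played within distance `n` of the current position. -/
abbrev LocalGame {V C : Type*} (c : V → C) (H : SimpleGraph V) (n : ℕ) :
    ℕ → Set (V × V) → Prop :=
  BackForth (ColAtoms c H n) (nbhd H n)

/-- The game without restriction on the moves. -/
abbrev FullGame {V C : Type*} (c : V → C) (H : SimpleGraph V) : ℕ → Set (V × V) → Prop :=
  BackForth (ColAtoms c H 1) (fun _ => Set.univ)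

/-- The diagonal of `F`. -/
def diag {V : Type*} (F : Set V) : Set (V × V) := {p | p.1 = p.2 ∧ p.1 ∈ F}

theorem swap_diag {V : Type*} (F : Set V) : Prod.swap ⁻¹' diag F = diag F := by
  ext ⟨a, b⟩
  simp only [diag, Set.mem_preimage, Set.mem_ofPred_eq, Prod.swap]
  constructor <;> (rintro ⟨rfl, h⟩; exact ⟨rfl, h⟩)

section Coloured

variable {V C : Type*} {c : V → C} {H : SimpleGraph V}

theorem ColAtoms.symm {n : ℕ} {R : Set (V × V)} (h : ColAtoms c H n R) :
    ColAtoms c H n (Prod.swap ⁻¹' R) :=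
  ⟨fun _ hp => (h.1 _ hp).symm, fun _ hp _ hq j hj => (h.2 _ hp _ hq j hj).symm⟩

theorem ColAtoms.subset {n : ℕ} {R R' : Set (V × V)} (hR : R ⊆ R') (h : ColAtoms c H n R') :
    ColAtoms c H n R :=
  ⟨fun _ hp => h.1 _ (hR hp), fun _ hp _ hq => h.2 _ (hR hp) _ (hR hq)⟩

theorem ColAtoms.mono {m n : ℕ} (hmn : m ≤ n) {R : Set (V × V)} (h : ColAtoms c H n R) :
    ColAtoms c H m R :=
  ⟨h.1, fun p hp q hq j hj => h.2 p hp q hq j (hj.trans hmn)⟩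

theorem nbhd_mono {m n : ℕ} (hmn : m ≤ n) (X : Set V) : nbhd H m X ⊆ nbhd H n X :=
  fun _ ⟨x, hx, h⟩ => ⟨x, hx, h.mono hmn⟩

theorem nbhd_monotone (n : ℕ) : Monotone (nbhd H n) :=
  fun _ _ hX _ ⟨x, hx, h⟩ => ⟨x, hX hx, h⟩

theorem LocalGame.symm {n k : ℕ} {R : Set (V × V)} (h : LocalGame c H n k R) :
    LocalGame c H n k (Prod.swap ⁻¹' R) :=
  BackForth.symm (At := ColAtoms c H n) (fun _ => ColAtoms.symm) h

theorem FullGame.symm {k : ℕ} {R : Set (V × V)} (h : FullGame c H k R) :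
    FullGame c H k (Prod.swap ⁻¹' R) :=
  BackForth.symm (At := ColAtoms c H 1) (fun _ => ColAtoms.symm) h

theorem LocalGame.subset {n k : ℕ} {R R' : Set (V × V)} (hR : R ⊆ R')
    (h : LocalGame c H n k R') : LocalGame c H n k R :=
  BackForth.subset (fun _ _ => ColAtoms.subset) (nbhd_monotone n) hR h

theorem LocalGame.mono {m n k l : ℕ} (hmn : m ≤ n) (hkl : k ≤ l) {R : Set (V × V)}
    (h : LocalGame c H n l R) : LocalGame c H m k R :=
  BackForth.imp (R₀ := R) (fun _ _ => ColAtoms.mono hmn) (nbhd_mono hmn) subset_rfl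
    (BackForth.of_le hkl h)

theorem LocalGame.refl (n k : ℕ) (x : V) : LocalGame c H n k {(x, x)} := by
  refine BackForth.of_invariant (fun _ R => ∀ p ∈ R, p.1 = p.2) ?_ ?_ ?_ ?_
  · exact fun _ _ h p hp => (h _ hp).symm
  · exact fun _ R h => ⟨fun p hp => by rw [h p hp],
      fun p hp q hq j _ => by rw [h p hp, h q hq]⟩
  · intro _ R h w _
    refine ⟨w, ?_⟩
    rintro p (rfl | hp)
    · rfl
    · exact h p hp
  · rintro p rfl
    rfl

/-- Local equivalence is transitive: an answer in the first game is fed as a move into the second.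
-/
theorem LocalGame.comp {n k : ℕ} {P Q R : Set (V × V)} (hP : LocalGame c H n k P)
    (hQ : LocalGame c H n k Q) (hR : ∀ p ∈ R, ∃ y, (p.1, y) ∈ P ∧ (y, p.2) ∈ Q) :
    LocalGame c H n k R := by
  refine BackForth.of_invariant (fun k R => ∃ P Q, LocalGame c H n k P ∧ LocalGame c H n k Q ∧
    ∀ p ∈ R, ∃ y, (p.1, y) ∈ P ∧ (y, p.2) ∈ Q) ?_ ?_ ?_ ⟨P, Q, hP, hQ, hR⟩
  · rintro k R ⟨P, Q, hP, hQ, hR⟩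
    refine ⟨_, _, hQ.symm, hP.symm, fun p hp => ?_⟩
    obtain ⟨y, h1, h2⟩ := hR _ hp
    exact ⟨y, h2, h1⟩
  · rintro k R ⟨P, Q, hP, hQ, hR⟩
    have hP := hP.atoms
    have hQ := hQ.atoms
    refine ⟨fun p hp => ?_, fun p hp q hq j hj => ?_⟩
    · obtain ⟨y, h1, h2⟩ := hR _ hp
      exact (hP.1 _ h1).trans (hQ.1 _ h2)
    · obtain ⟨y, h1, h2⟩ := hR _ hp
      obtain ⟨z, h3, h4⟩ := hR _ hq
      exact (hP.2 _ h1 _ h3 j hj).trans (hQ.2 _ h2 _ h4 j hj)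
  · rintro k R ⟨P, Q, hP, hQ, hR⟩ w ⟨_, ⟨p, hp, rfl⟩, hw⟩
    obtain ⟨y, h1, h2⟩ := hR _ hp
    obtain ⟨w', hw'⟩ := hP.2.1 w ⟨_, ⟨_, h1, rfl⟩, hw⟩
    -- Preservation of distances up to `n` makes `w'` a legal local move in the second game.
    have hy : Near H n y w' :=
      (hw'.atoms.2 _ (.inr h1) _ (.inl rfl) n le_rfl).1 hw
    obtain ⟨w'', hw''⟩ := hQ.2.1 w' ⟨_, ⟨_, h2, rfl⟩, hy⟩
    refine ⟨w'', _, _, hw', hw'', ?_⟩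
    rintro q (rfl | hq)
    · exact ⟨w', .inl rfl, .inl rfl⟩
    · obtain ⟨y, h1, h2⟩ := hR _ hq
      exact ⟨y, .inr h1, .inr h2⟩

/-- Local strategies on far-apart positions can be combined. -/
theorem LocalGame.union {n k : ℕ} {P Q : Set (V × V)} (hP : LocalGame c H n k P)
    (hQ : LocalGame c H n k Q)
    (hfar : ∀ p ∈ P, ∀ q ∈ Q, ¬ Near H (n * (k + 1)) p.1 q.1 ∧ ¬ Near H (n * (k + 1)) p.2 q.2) :
    LocalGame c H n k (P ∪ Q) := by
  refine BackForth.of_invariant (fun k R => ∃ P Q, R = P ∪ Q ∧ LocalGame c H n k P ∧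
    LocalGame c H n k Q ∧ ∀ p ∈ P, ∀ q ∈ Q, ¬ Near H (n * (k + 1)) p.1 q.1 ∧
      ¬ Near H (n * (k + 1)) p.2 q.2) ?_ ?_ ?_ ⟨P, Q, rfl, hP, hQ, hfar⟩
  · rintro k _ ⟨P, Q, rfl, hP, hQ, hfar⟩
    exact ⟨_, _, rfl, hP.symm, hQ.symm, fun p hp q hq => (hfar _ hp _ hq).symm⟩
  · rintro k _ ⟨P, Q, rfl, hP, hQ, hfar⟩
    have hP := hP.atoms
    have hQ := hQ.atoms
    refine ⟨?_, ?_⟩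
    · rintro p (hp | hp)
      exacts [hP.1 p hp, hQ.1 p hp]
    · have key : ∀ p ∈ P, ∀ q ∈ Q, ∀ j ≤ n, (Near H j p.1 q.1 ↔ Near H j p.2 q.2) := by
        intro p hp q hq j hj
        have hj : j ≤ n * (k + 1) := hj.trans (Nat.le_mul_of_pos_right _ (Nat.succ_pos _))
        obtain ⟨h1, h2⟩ := hfar p hp q hq
        exact iff_of_false (fun h => h1 (h.mono hj)) (fun h => h2 (h.mono hj))
      rintro p (hp | hp) q (hq | hq) j hj
      · exact hP.2 p hp q hq j hj
      · exact key p hp q hq j hj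
      · rw [Near.comm, key q hq p hp j hj, Near.comm]
      · exact hQ.2 p hp q hq j hj
  -- A local move stays within `n` of one part on both sides, so each round costs at most `n` of the
  -- separation `n * (k + 1)`; the other part keeps its strategy unplayed.
  · have key : ∀ (k : ℕ) (P Q : Set (V × V)), LocalGame c H n (k + 1) P →
        LocalGame c H n (k + 1) Q → (∀ p ∈ P, ∀ q ∈ Q, ¬ Near H (n * (k + 1 + 1)) p.1 q.1 ∧
          ¬ Near H (n * (k + 1 + 1)) p.2 q.2) → ∀ p ∈ P, ∀ w, Near H n p.1 w →
        ∃ w', LocalGame c H n k (insert (w, w') P) ∧ ∀ p ∈ insert (w, w') P, ∀ q ∈ Q,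
          ¬ Near H (n * (k + 1)) p.1 q.1 ∧ ¬ Near H (n * (k + 1)) p.2 q.2 := by
      intro k P Q hP hQ hfar p hp w hw
      obtain ⟨w', hw'⟩ := hP.2.1 w ⟨_, ⟨_, hp, rfl⟩, hw⟩
      refine ⟨w', hw', ?_⟩
      have hy : Near H n p.2 w' :=
        (hw'.atoms.2 _ (.inr hp) _ (.inl rfl) n le_rfl).1 hw
      have hn : n + n * (k + 1) = n * (k + 1 + 1) := by ring
      rintro p' (rfl | hp') q hq
      · obtain ⟨h1, h2⟩ := hfar p hp q hq
        rw [← hn] at h1 h2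
        exact ⟨fun h => h1 (hw.trans h), fun h => h2 (hy.trans h)⟩
      · obtain ⟨h1, h2⟩ := hfar p' hp' q hq
        have hle : n * (k + 1) ≤ n * (k + 1 + 1) := by omega
        exact ⟨fun h => h1 (h.mono hle), fun h => h2 (h.mono hle)⟩
    rintro k _ ⟨P, Q, rfl, hP, hQ, hfar⟩ w ⟨_, ⟨p, hp | hp, rfl⟩, hw⟩
    · obtain ⟨w', h1, h2⟩ := key k P Q hP hQ hfar p hp w hw
      exact ⟨w', _, _, (Set.insert_union ..).symm, h1, hQ.of_succ, h2⟩
    · obtain ⟨w', h1, h2⟩ := key k Q P hQ hP (fun p hp q hq =>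
        ⟨fun h => (hfar q hq p hp).1 h.symm, fun h => (hfar q hq p hp).2 h.symm⟩) p hp w hw
      refine ⟨w', _, _, (Set.union_insert ..).symm, hP.of_succ, h1, fun p hp q hq =>
        ⟨fun h => (h2 q hq p hp).1 h.symm, fun h => (h2 q hq p hp).2 h.symm⟩⟩

/-- One round buys one unit of distance: play the vertex one step along a short walk and compare the
remainder with one round fewer. -/
theorem FullGame.colAtoms {k : ℕ} {R : Set (V × V)} (h : FullGame c H k R) :
    ColAtoms c H (k + 1) R := by
  induction k generalizing R with
  | zero => exact h
  | succ k ih =>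
    have key : ∀ R : Set (V × V), FullGame c H (k + 1) R → ∀ p ∈ R, ∀ q ∈ R,
        Near H (k + 1 + 1) p.1 q.1 → Near H (k + 1 + 1) p.2 q.2 := by
      intro R h p hp q hq hpq
      obtain ⟨z, h1, h2⟩ := hpq.split
      obtain ⟨z', hz⟩ := h.2.1 z trivial
      have hz := ih hz
      have h1' := (hz.2 _ (.inr hp) _ (.inl rfl) 1 (by omega)).1 h1
      have h2' := (hz.2 _ (.inl rfl) _ (.inr hq) (k + 1) le_rfl).1 h2
      exact (h1'.trans h2').mono (by omega)
    refine ⟨h.1.1, fun p hp q hq j hj => ?_⟩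
    rcases Nat.lt_or_eq_of_le hj with hj | rfl
    · exact (ih h.of_succ).2 p hp q hq j (by omega)
    · exact ⟨key R h p hp q hq, key _ h.symm p.swap (by simpa using hp)
        q.swap (by simpa using hq)⟩

/-- The `n` spare rounds are never played; they guarantee that distances up to `n` are still
preserved at the end. -/
theorem FullGame.localGame {n k : ℕ} {R : Set (V × V)} (h : FullGame c H (k + n) R) :
    LocalGame c H n k R := by
  refine BackForth.of_invariant (fun k R => FullGame c H (k + n) R) ?_ ?_ ?_ h
  · exact fun _ _ h => FullGame.symm h
  · exact fun k R h => h.colAtoms.mono (by omega)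
  · intro k R h w _
    have h : FullGame c H (k + n + 1) R := by rwa [Nat.add_right_comm] at h
    exact h.2.1 w trivial

end Coloured

/-! ### From local strategies to unrestricted ones. -/

section Coloured

variable {V C : Type*} {c : V → C} {H : SimpleGraph V}

/-- A vertex far from the left side of a position has a locally equivalent vertex far from the
right side. -/
theorem LocalGame.exists_far {r n k N : ℕ} {P : Set (V × V)} (hr : 2 * r ≤ n)
    (hP : LocalGame c H n (k + N) P) (hcard : P.encard ≤ N) {w : V}
    (hw : ∀ p ∈ P, ¬ Near H (3 * r) p.1 w) :
    ∃ w', (w' = w ∨ ∃ p ∈ P, Near H r p.1 w') ∧ (∀ p ∈ P, ¬ Near H r p.2 w') ∧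
      LocalGame c H n k {(w, w')} := by
  by_contra! hcon
  -- If every candidate is near the right side, start with `w` and repeatedly pull the last
  -- candidate back through the strategy to a vertex near the left side. Keeping all pairs `(f (i +
  -- 1), f i)` in a single position makes the distances among the `f i` comparable.
  have chain : ∀ j ≤ N, ∃ f : ℕ → V, f 0 = w ∧ (∀ i < j, ∃ p ∈ P, Near H r p.1 (f (i + 1))) ∧
      (∀ i ≤ j, ∃ p ∈ P, Near H r p.2 (f i)) ∧
      LocalGame c H n (k + (N - j)) (P ∪ {p | ∃ i < j, p = (f (i + 1), f i)}) := by
    intro j hj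
    induction j with
    | zero =>
      have h0 : ∃ p ∈ P, Near H r p.2 w := by
        by_contra! h
        exact hcon w (.inl rfl) h (LocalGame.refl _ _ _)
      refine ⟨fun _ => w, rfl, by simp, fun i _ => h0, ?_⟩
      simpa using hP
    | succ j ih =>
      obtain ⟨f, hf0, hf1, hf2, hf⟩ := ih (by omega)
      obtain ⟨p, hp, hpf⟩ := hf2 j le_rfl
      obtain ⟨m, hm⟩ : ∃ m, k + (N - j) = m + 1 := ⟨k + (N - j) - 1, by omega⟩
      rw [hm] at hf
      obtain ⟨z, hz⟩ := hf.2.2 (f j) ⟨_, ⟨p, .inl hp, rfl⟩, hpf.mono (by omega)⟩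
      have hm' : k + (N - (j + 1)) = m := by omega
      rw [hm']
      have hpz : Near H r p.1 z :=
        (hz.atoms.2 _ (.inr (.inl hp)) _ (.inl rfl) r (by omega)).2 hpf
      let g := Function.update f (j + 1) z
      have hgf : ∀ i ≤ j, g i = f i := fun i hi => Function.update_of_ne (by omega) _ _
      have hgz : g (j + 1) = z := Function.update_self ..
      have hg : LocalGame c H n m (P ∪ {p | ∃ i < j + 1, p = (g (i + 1), g i)}) := by
        refine LocalGame.subset ?_ hz
        rintro q (hq | ⟨i, hi, rfl⟩)
        · exact .inr (.inl hq)
        · rcases Nat.lt_succ_iff_lt_or_eq.1 hi with hi | rfl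
          · rw [hgf i (by omega), hgf (i + 1) (by omega)]
            exact .inr (.inr ⟨i, hi, rfl⟩)
          · rw [hgf i le_rfl, hgz]
            exact .inl rfl
      -- Each link is a local equivalence, so composing the reversed links relates `w` to every
      -- candidate.
      have hlocal : ∀ i ≤ j + 1, LocalGame c H n m {(w, g i)} := by
        intro i hi
        induction i with
        | zero =>
          rw [hgf 0 (by omega), hf0]
          exact LocalGame.refl _ _ _
        | succ i ih =>
          refine (ih (by omega)).comp hg.symm ?_
          rintro _ rfl
          exact ⟨g i, rfl, .inr ⟨i, by omega, rfl⟩⟩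
      refine ⟨g, by rw [hgf 0 (by omega), hf0], fun i hi => ?_, fun i hi => ?_, hg⟩
      · rcases Nat.lt_succ_iff_lt_or_eq.1 hi with hi | rfl
        · rw [hgf (i + 1) (by omega)]
          exact hf1 i hi
        · rw [hgz]
          exact ⟨p, hp, hpz⟩
      · rcases Nat.le_succ_iff.1 hi with hi | rfl
        · rw [hgf i hi]
          exact hf2 i hi
        · by_contra! h
          refine hcon (g (j + 1)) (.inr ⟨p, hp, by rwa [hgz]⟩) h ?_
          exact (hlocal _ le_rfl).mono le_rfl (by omega)
  obtain ⟨f, hf0, hf1, hf2, hf⟩ := chain N le_rfl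
  -- `f 0 = w` is more than `3 * r` from the left side while later `f i'` are within `r` of it, so
  -- they are more than `2 * r` apart. Distance preservation shifts both indices up by one.
  have hscat : ∀ i i', i < i' → i' ≤ N → ¬ Near H (2 * r) (f i) (f i') := by
    intro i
    induction i with
    | zero =>
      intro i' hi hi' h
      obtain ⟨j, rfl⟩ : ∃ j, i' = j + 1 := ⟨i' - 1, by omega⟩
      obtain ⟨p, hp, hpf⟩ := hf1 j (by omega)
      rw [hf0] at h
      exact hw p hp ((hpf.trans h.symm).mono (by omega))
    | succ i ih =>
      intro i' hi hi' h
      obtain ⟨j, rfl⟩ : ∃ j, i' = j + 1 := ⟨i' - 1, by omega⟩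
      exact ih j (by omega) (by omega) ((hf.atoms.2 _ (.inr ⟨i, by omega, rfl⟩) _
        (.inr ⟨j, by omega, rfl⟩) (2 * r) hr).1 h)
  have : Nonempty (V × V) := ⟨(w, w)⟩
  choose! p hpP hp using hf2
  -- Two candidates near the same right vertex would be within `2 * r`; hence `N + 1` candidates
  -- need `N + 1` distinct pairs of `P`.
  have hinj : Set.InjOn p (Set.Iic N) := by
    have key : ∀ i i', i < i' → i' ≤ N → p i ≠ p i' := by
      intro i i' hi hi' h
      have h1 := hp i (by omega)
      rw [h] at h1
      exact hscat i i' hi hi' ((h1.symm.trans (hp i' hi')).mono (by omega))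
    intro i hi i' hi' h
    rcases lt_trichotomy i i' with hlt | heq | hlt
    · exact absurd h (key _ _ hlt hi')
    · exact heq
    · exact absurd h.symm (key _ _ hlt hi)
  have h1 : (p '' Set.Iic N).encard ≤ P.encard :=
    Set.encard_le_encard (by rintro _ ⟨i, hi, rfl⟩; exact hpP i hi)
  rw [hinj.encard_image] at h1
  have h2 : (Set.Iic N).encard = ((N + 1 : ℕ) : ℕ∞) := by
    rw [← Finset.coe_Iic, Set.encard_coe_eq_coe_finsetCard, Nat.card_Iic]
  rw [h2] at h1
  have h3 := h1.trans hcard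
  norm_cast at h3
  omega

/-- A local strategy on a small position far from `F` extends to a strategy for the full game
that fixes `F`. -/
theorem LocalGame.fullGame {ρ σ : ℕ → ℕ} {N : ℕ} (hρ0 : 1 ≤ ρ 0) (hσ0 : 1 ≤ σ 0) {q : ℕ}
    (hρ : ∀ k < q, 3 * (ρ k * (k * N + 1)) ≤ ρ (k + 1))
    (hσ : ∀ k < q, 2 * σ k + ρ (k + 1) ≤ σ (k + 1)) {P : Set (V × V)} {F : Set V}
    (hcard : P.encard + q ≤ N) (hP : LocalGame c H (ρ q) (q * N) P)
    (hfar : ∀ p ∈ P, ∀ f ∈ F, ¬ Near H (σ q) p.1 f ∧ ¬ Near H (σ q) p.2 f) :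
    FullGame c H q (P ∪ diag F) := by
  have hρ1 : ∀ k ≤ q, 1 ≤ ρ k ∧ 1 ≤ σ k := by
    intro k hk
    induction k with
    | zero => exact ⟨hρ0, hσ0⟩
    | succ k ih =>
      have h1 := hρ k hk
      have h2 := hσ k hk
      have h3 := ih (by omega)
      have h4 : ρ k ≤ ρ k * (k * N + 1) := Nat.le_mul_of_pos_right _ (Nat.succ_pos _)
      omega
  -- With `k` rounds left, `P` keeps room for `k` more pairs and a local strategy of length `k * N`:
  -- each round may spend `N` local rounds on `exists_far`. Both `P` and `F` may grow.
  refine BackForth.of_invariant (fun k R => k ≤ q ∧ ∃ P F, R ⊆ P ∪ diag F ∧ P.encard + k ≤ N ∧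
    LocalGame c H (ρ k) (k * N) P ∧
    ∀ p ∈ P, ∀ f ∈ F, ¬ Near H (σ k) p.1 f ∧ ¬ Near H (σ k) p.2 f) ?_ ?_ ?_
    ⟨le_rfl, P, F, subset_rfl, hcard, hP, hfar⟩
  · rintro k R ⟨hk, P, F, hR, hcard, hP, hfar⟩
    refine ⟨hk, _, F, ?_, ?_, hP.symm, fun p hp f hf => (hfar _ hp f hf).symm⟩
    · rw [← swap_diag F, ← Set.preimage_union]
      exact Set.preimage_mono hR
    · rwa [Set.encard_preimage_of_bijective Prod.swap_bijective]
  · rintro k R ⟨hk, P, F, hR, hcard, hP, hfar⟩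
    obtain ⟨hρk, hσk⟩ := hρ1 k hk
    have hP := hP.atoms.mono hρk
    refine ColAtoms.subset hR ⟨?_, ?_⟩
    · rintro p (hp | ⟨hp, -⟩)
      exacts [hP.1 p hp, congrArg c hp]
    · have key : ∀ p ∈ P, ∀ q ∈ diag F, ∀ j ≤ 1, (Near H j p.1 q.1 ↔ Near H j p.2 q.2) := by
        rintro p hp ⟨f, f'⟩ ⟨hff, hf⟩ j hj
        obtain rfl : f = f' := hff
        obtain ⟨h1, h2⟩ := hfar p hp f hf
        exact iff_of_false (fun h => h1 (h.mono (by omega))) (fun h => h2 (h.mono (by omega)))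
      rintro p (hp | hp) p' (hp' | hp') j hj
      · exact hP.2 p hp p' hp' j hj
      · exact key p hp p' hp' j hj
      · rw [Near.comm, key p' hp' p hp j hj, Near.comm]
      · rw [hp.1, hp'.1]
  · rintro k R ⟨hk, P, F, hR, hcard, hP, hfar⟩ w -
    have hρk := hρ k hk
    have hσk := hσ k hk
    -- Exactly the separation that `LocalGame.union` requires for radius `ρ k` and length `k * N`.
    set r := ρ k * (k * N + 1) with hr
    have hρr : ρ k ≤ r := Nat.le_mul_of_pos_right _ (Nat.succ_pos _)
    have hcard' : P.encard ≤ N := le_trans le_self_add hcard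
    have hNk : k + 1 ≤ N := by
      have : ((k + 1 : ℕ) : ℕ∞) ≤ N := le_trans le_add_self hcard
      exact_mod_cast this
    have hmul : (k + 1) * N = k * N + N := Nat.succ_mul _ _
    have hinsert : ∀ w', (insert (w, w') P).encard + k ≤ N := by
      intro w'
      refine le_trans ?_ hcard
      calc (insert (w, w') P).encard + (k : ℕ∞) ≤ (P.encard + 1) + k := by
            gcongr; exact Set.encard_insert_le _ _
        _ = P.encard + ((k + 1 : ℕ) : ℕ∞) := by push_cast; ring
    have hfarP : ∀ p ∈ P, ∀ f ∈ F, ¬ Near H (σ k) p.1 f ∧ ¬ Near H (σ k) p.2 f :=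
      fun p hp f hf => ⟨fun h => (hfar p hp f hf).1 (h.mono (by omega)),
        fun h => (hfar p hp f hf).2 (h.mono (by omega))⟩
    by_cases h1 : ∃ f ∈ F, Near H (σ k) f w
    · obtain ⟨f, hf, hfw⟩ := h1
      refine ⟨w, by omega, P, insert w F, ?_, ?_, hP.mono (by omega) (by omega), ?_⟩
      · rintro p (rfl | hp)
        · exact .inr ⟨rfl, .inl rfl⟩
        · rcases hR hp with hp | hp
          · exact .inl hp
          · exact .inr ⟨hp.1, .inr hp.2⟩
      · refine le_trans ?_ hcard
        gcongr
        omega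
      · rintro p hp g (rfl | hg)
        · obtain ⟨h2, h3⟩ := hfar p hp f hf
          exact ⟨fun h => h2 ((h.trans hfw.symm).mono (by omega)),
            fun h => h3 ((h.trans hfw.symm).mono (by omega))⟩
        · exact hfarP p hp g hg
    push Not at h1
    by_cases h2 : ∃ p ∈ P, Near H (3 * r) p.1 w
    · obtain ⟨p, hp, hpw⟩ := h2
      obtain ⟨m, hm⟩ : ∃ m, (k + 1) * N = m + 1 := ⟨(k + 1) * N - 1, by omega⟩
      rw [hm] at hP
      obtain ⟨w', hw'⟩ := hP.2.1 w ⟨_, ⟨p, hp, rfl⟩, hpw.mono hρk⟩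
      have hpw' : Near H (3 * r) p.2 w' :=
        (hw'.atoms.2 _ (.inr hp) _ (.inl rfl) (3 * r) hρk).1 hpw
      refine ⟨w', by omega, insert (w, w') P, F, ?_, hinsert w', LocalGame.mono (by omega) (by omega) hw', ?_⟩
      · rw [Set.insert_union]
        exact Set.insert_subset_insert hR
      · rintro p' (rfl | hp') f hf
        · obtain ⟨h3, h4⟩ := hfar p hp f hf
          exact ⟨fun h => h3 ((hpw.trans h).mono (by omega)),
            fun h => h4 ((hpw'.trans h).mono (by omega))⟩
        · exact hfarP p' hp' f hf
    · push Not at h2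
      rw [hmul] at hP
      obtain ⟨w', hw', hfar', hloc⟩ := hP.exists_far (r := r) (by omega) hcard' h2
      refine ⟨w', by omega, insert (w, w') P, F, ?_, hinsert w', ?_, ?_⟩
      · rw [Set.insert_union]
        exact Set.insert_subset_insert hR
      · rw [← Set.union_singleton]
        refine (hP.mono (by omega) (by omega)).union (hloc.mono (by omega) le_rfl) ?_
        rintro p hp _ rfl
        exact ⟨fun h => h2 p hp (h.mono (by omega)), hfar' p hp⟩
      · rintro p' (rfl | hp') f hf
        · refine ⟨fun h => h1 f hf h.symm, fun h => ?_⟩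
          -- The new right vertex is `w` itself or lies near the left side of `P`; both are far from
          -- `F`.
          rcases hw' with rfl | ⟨p, hp, hpw⟩
          · exact h1 f hf h.symm
          · exact (hfar p hp f hf).1 ((hpw.trans h).mono (by omega))
        · exact hfarP p' hp' f hf

end Coloured

/-! ### Removing the separator. -/

/-- The position `R` is a partial isomorphism of `G`. -/
def GraphAtoms {V : Type*} (G : SimpleGraph V) (R : Set (V × V)) : Prop :=
  ∀ p ∈ R, ∀ q ∈ R, (p.1 = q.1 ↔ p.2 = q.2) ∧ (G.Adj p.1 q.1 ↔ G.Adj p.2 q.2)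

/-- The Ehrenfeucht–Fraïssé game on `G`. -/
abbrev GraphGame {V : Type*} (G : SimpleGraph V) : ℕ → Set (V × V) → Prop :=
  BackForth (GraphAtoms G) (fun _ => Set.univ)

/-- The position that pairs the entries of two tuples. -/
def pairs {V ι : Type*} (x x' : ι → V) : Set (V × V) := Set.range fun i => (x i, x' i)

theorem swap_pairs {V ι : Type*} (x x' : ι → V) : Prod.swap ⁻¹' pairs x x' = pairs x' x := by
  ext ⟨a, b⟩
  simp [pairs, and_comm]

/-- The graph `G` without the edges that meet `S`. -/
def offGraph {V : Type*} (G : SimpleGraph V) (S : Set V) : SimpleGraph V where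
  Adj x y := G.Adj x y ∧ x ∉ S ∧ y ∉ S
  symm := ⟨fun _ _ h => ⟨h.1.symm, h.2.2, h.2.1⟩⟩
  loopless := ⟨fun _ h => G.loopless.irrefl _ h.1⟩

/-- The colour of a vertex records its equality and adjacency with members of `S`. -/
def colour {V : Type*} (G : SimpleGraph V) (S : Set V) (x : V) : Set V × Set V :=
  ({s | s ∈ S ∧ x = s}, {s | s ∈ S ∧ G.Adj x s})

section Graph

variable {V : Type*} {G : SimpleGraph V}

theorem GraphAtoms.symm {R : Set (V × V)} (h : GraphAtoms G R) :
    GraphAtoms G (Prod.swap ⁻¹' R) :=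
  fun _ hp _ hq => ⟨(h _ hp _ hq).1.symm, (h _ hp _ hq).2.symm⟩

theorem GraphAtoms.subset {R R' : Set (V × V)} (hR : R ⊆ R') (h : GraphAtoms G R') :
    GraphAtoms G R :=
  fun _ hp _ hq => h _ (hR hp) _ (hR hq)

theorem GraphGame.subset {k : ℕ} {R R' : Set (V × V)} (hR : R ⊆ R') (h : GraphGame G k R') :
    GraphGame G k R :=
  BackForth.subset (fun _ _ => GraphAtoms.subset) (fun _ _ _ => subset_rfl) hR h

theorem GraphAtoms.colAtoms {S : Set V} {R : Set (V × V)} (hS : diag S ⊆ R)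
    (h : GraphAtoms G R) : ColAtoms (colour G S) (offGraph G S) 1 R := by
  have hs : ∀ p ∈ R, ∀ s ∈ S, (p.1 = s ↔ p.2 = s) ∧ (G.Adj p.1 s ↔ G.Adj p.2 s) :=
    fun p hp s hs => h p hp (s, s) (hS ⟨rfl, hs⟩)
  have hmem : ∀ p ∈ R, (p.1 ∈ S ↔ p.2 ∈ S) := by
    intro p hp
    constructor
    · intro h1
      rwa [(hs p hp _ h1).1.1 rfl]
    · intro h1
      rwa [(hs p hp _ h1).1.2 rfl]
  refine ⟨fun p hp => Prod.ext (Set.ext fun s => ?_) (Set.ext fun s => ?_), ?_⟩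
  · exact and_congr_right fun h1 => (hs p hp s h1).1
  · exact and_congr_right fun h1 => (hs p hp s h1).2
  · intro p hp q hq j hj
    rcases Nat.le_one_iff_eq_zero_or_eq_one.1 hj with rfl | rfl
    · simpa only [Near.zero_iff] using (h p hp q hq).1
    · simp only [Near.one_iff, offGraph, hmem p hp, hmem q hq, (h p hp q hq).1, (h p hp q hq).2]

theorem ColAtoms.graphAtoms {S : Set V} {R : Set (V × V)}
    (h : ColAtoms (colour G S) (offGraph G S) 1 R) : GraphAtoms G R := by
  have hs : ∀ p ∈ R, ∀ s ∈ S, (p.1 = s ↔ p.2 = s) ∧ (G.Adj p.1 s ↔ G.Adj p.2 s) := by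
    intro p hp s hs
    have h1 : s ∈ (colour G S p.1).1 ↔ s ∈ (colour G S p.2).1 := by rw [h.1 p hp]
    have h2 : s ∈ (colour G S p.1).2 ↔ s ∈ (colour G S p.2).2 := by rw [h.1 p hp]
    exact ⟨(and_congr_right_iff.1 h1) hs, (and_congr_right_iff.1 h2) hs⟩
  intro p hp q hq
  have heq : p.1 = q.1 ↔ p.2 = q.2 := by
    simpa only [Near.zero_iff] using h.2 p hp q hq 0 zero_le_one
  refine ⟨heq, ?_⟩
  by_cases hp1 : p.1 ∈ S
  · rw [(hs p hp _ hp1).1.1 rfl, G.adj_comm, G.adj_comm p.1]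
    exact (hs q hq _ hp1).2
  by_cases hq1 : q.1 ∈ S
  · rw [(hs q hq _ hq1).1.1 rfl]
    exact (hs p hp _ hq1).2
  have hp2 : p.2 ∉ S := fun h2 => hp1 (by rwa [(hs p hp _ h2).1.2 rfl])
  have hq2 : q.2 ∉ S := fun h2 => hq1 (by rwa [(hs q hq _ h2).1.2 rfl])
  have h1 := h.2 p hp q hq 1 le_rfl
  simp only [Near.one_iff, offGraph, hp1, hq1, hp2, hq2, not_false_eq_true, and_true, heq] at h1
  by_cases h2 : p.2 = q.2
  · rw [heq.2 h2, h2]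
    simp
  · simpa only [h2, false_or] using h1

theorem support_notMem_of_offGraph {S : Set V} {x y : V} (w : (offGraph G S).Walk x y)
    (hx : x ∉ S) : ∀ v ∈ w.support, v ∉ S := by
  induction w with
  | nil => simpa using hx
  | cons h w ih =>
    intro v hv
    rw [SimpleGraph.Walk.support_cons, List.mem_cons] at hv
    rcases hv with rfl | hv
    · exact hx
    · exact ih h.2.2 v hv

/-- A walk of `offGraph G S` starting outside `S` never meets `S`; shortened to a path of `G`, it
would violate separation. -/
theorem Separated.not_near {r : ℕ} {A B S : Set V} (h : Separated G r A B S) {a b : V}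
    (ha : a ∈ A) (haS : a ∉ S) (hb : b ∈ B ∪ S) : ¬ Near (offGraph G S) r a b := by
  classical
  rintro ⟨w, hw⟩
  have hsupp := support_notMem_of_offGraph w haS
  rcases hb with hb | hb
  · have hle : offGraph G S ≤ G := fun _ _ h => h.1
    obtain ⟨v, hv, hvS⟩ := h a ha b hb (w.mapLe hle).bypass
      (SimpleGraph.Walk.bypass_isPath _)
      ((SimpleGraph.Walk.length_bypass_le_length _).trans (by simpa using hw))
    have hv := SimpleGraph.Walk.support_bypass_subset_support _ hv
    rw [SimpleGraph.Walk.support_mapLe_eq_support] at hv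
    exact hsupp v hv hvS
  · exact hsupp b w.end_mem_support hb

/-- The rank over the separator which determines rank-`q` types of `d`-tuples. -/
def sepRank (q d : ℕ) : ℕ := q * (d + q) + (3 * (q * (d + q) + 1)) ^ q

/-- The sufficient separation radius. -/
def sepRadius (q d : ℕ) : ℕ := (2 * (3 * (q * (d + q) + 1))) ^ q

theorem GraphGame.of_separated {q d : ℕ} {A B S : Set V}
    (hsep : Separated G (sepRadius q d) A B S) {u u' : Fin d → V} (hu : ∀ i, u i ∈ A)
    (hu' : ∀ i, u' i ∈ A) (h : GraphGame G (sepRank q d) (pairs u u' ∪ diag S)) :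
    GraphGame G q (pairs u u' ∪ diag B) := by
  have hfull : FullGame (colour G S) (offGraph G S) (sepRank q d) (pairs u u' ∪ diag S) :=
    BackForth.imp (R₀ := pairs u u' ∪ diag S)
      (fun R hR hAt => GraphAtoms.colAtoms (Set.subset_union_right.trans hR) hAt)
      (fun _ => subset_rfl) subset_rfl h
  set N := d + q with hN
  set K := 3 * (q * N + 1) with hK
  have hK3 : 3 ≤ K := by omega
  -- Pairs meeting `S` are diagonal, since the position contains `diag S`; they are absorbed into
  -- `diag (B ∪ S)` at the end.
  set P : Set (V × V) := {p | p ∈ pairs u u' ∧ p.1 ∉ S} with hP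
  have hPS : ∀ p ∈ P, p.2 ∉ S := by
    rintro p ⟨hp, hpS⟩ h2
    have h3 := ((h.atoms p (.inl hp) (p.2, p.2) (.inr ⟨rfl, h2⟩)).1).2 rfl
    exact hpS (by rw [h3]; exact h2)
  have hlocal := LocalGame.subset (R := P) (fun p hp => .inl hp.1)
    (FullGame.localGame (n := K ^ q) (k := q * N) hfull)
  have hcard : P.encard + q ≤ N := by
    have h1 : P.encard ≤ d := by
      calc P.encard ≤ (pairs u u').encard := Set.encard_le_encard fun _ hp => hp.1
        _ ≤ (Set.univ : Set (Fin d)).encard := by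
          rw [pairs, ← Set.image_univ]; exact Set.encard_image_le _ _
        _ = d := by simp
    rw [hN]
    push_cast
    gcongr
  have hgame : FullGame (colour G S) (offGraph G S) q (P ∪ diag (B ∪ S)) := by
    -- At `k = q` these radii are the `K ^ q` in `sepRank` and the value of `sepRadius`.
    refine LocalGame.fullGame (ρ := fun k => K ^ k) (σ := fun k => (2 * K) ^ k) (N := N)
      (by simp) (by simp) (fun k hk => ?_) (fun k hk => ?_) hcard hlocal ?_
    · have h1 : 3 * (k * N + 1) ≤ K := by
        have := Nat.mul_le_mul_right N hk.le
        omega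
      calc 3 * (K ^ k * (k * N + 1)) = K ^ k * (3 * (k * N + 1)) := by ring
        _ ≤ K ^ k * K := Nat.mul_le_mul_left _ h1
        _ = K ^ (k + 1) := (pow_succ _ _).symm
    · have h1 : K ^ k ≤ (2 * K) ^ k := Nat.pow_le_pow_left (by omega) k
      calc 2 * (2 * K) ^ k + K ^ (k + 1) = 2 * (2 * K) ^ k + K * K ^ k := by ring
        _ ≤ K * (2 * K) ^ k + K * (2 * K) ^ k := by gcongr; omega
        _ = (2 * K) ^ (k + 1) := by ring
    · rintro p hp f hf
      have hpS := hPS p hp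
      obtain ⟨⟨i, rfl⟩, hpS'⟩ := hp
      exact ⟨hsep.not_near (hu i) hpS' hf, hsep.not_near (hu' i) hpS hf⟩
  have hgame' : GraphGame G q (P ∪ diag (B ∪ S)) :=
    BackForth.imp (R₀ := P ∪ diag (B ∪ S)) (fun _ _ hAt => hAt.graphAtoms)
      (fun _ => subset_rfl) subset_rfl hgame
  refine GraphGame.subset ?_ hgame'
  rintro p (hp | hp)
  · by_cases hpS : p.1 ∈ S
    · refine .inr ⟨?_, .inr hpS⟩
      exact (((h.atoms p (.inl hp) (p.1, p.1) (.inr ⟨rfl, hpS⟩)).1).1 rfl).symm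
    · exact .inl ⟨hp, hpS⟩
  · exact .inr ⟨hp.1, .inl hp.2⟩

end Graph

/-! ### Games and first-order formulas. -/

section Formulas

variable {V : Type*} {G : SimpleGraph V}

/-- Satisfaction of formulas with bound variables in a graph. -/
def BSat (G : SimpleGraph V) {α : Type} {n : ℕ} (φ : Language.graph.BoundedFormula α n)
    (e : α → V) (xs : Fin n → V) : Prop :=
  @Language.BoundedFormula.Realize _ V G.structure α n φ e xs

theorem exists_realize_eq (G : SimpleGraph V) {β : Type} (t : Language.graph.Term β) :
    ∃ i, ∀ x : β → V, @Language.Term.realize _ V G.structure β x t = x i := by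
  cases t with
  | var i => exact ⟨i, fun _ => rfl⟩
  | func f _ => exact Empty.elim f

theorem insert_pairs_snoc {α : Type} {n : ℕ} (e e' : α → V) (xs xs' : Fin n → V) (w w' : V) :
    pairs (Sum.elim e (Fin.snoc xs w : Fin (n + 1) → V))
        (Sum.elim e' (Fin.snoc xs' w' : Fin (n + 1) → V)) =
      insert (w, w') (pairs (Sum.elim e xs) (Sum.elim e' xs')) := by
  ext p
  simp only [pairs, Set.mem_range, Set.mem_insert_iff, Sum.exists, Sum.elim_inl, Sum.elim_inr,
    Fin.exists_fin_succ', Fin.snoc_castSucc, Fin.snoc_last]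
  tauto

theorem GraphGame.bSat_iff {α : Type} {n k : ℕ} {φ : Language.graph.BoundedFormula α n}
    (hφ : qrank φ ≤ k) {e e' : α → V} {xs xs' : Fin n → V}
    (h : GraphGame G k (pairs (Sum.elim e xs) (Sum.elim e' xs'))) :
    BSat G φ e xs ↔ BSat G φ e' xs' := by
  induction φ generalizing k with
  | falsum => exact Iff.rfl
  | equal t t' =>
    obtain ⟨i, hi⟩ := exists_realize_eq G t
    obtain ⟨j, hj⟩ := exists_realize_eq G t'
    have := (h.atoms _ ⟨i, rfl⟩ _ ⟨j, rfl⟩).1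
    simp only [BSat, Language.BoundedFormula.Realize, hi, hj]
    exact this
  | rel R ts =>
    cases R
    obtain ⟨i, hi⟩ := exists_realize_eq G (ts 0)
    obtain ⟨j, hj⟩ := exists_realize_eq G (ts 1)
    have := (h.atoms _ ⟨i, rfl⟩ _ ⟨j, rfl⟩).2
    simp only [← hi, ← hj] at this
    exact this
  | imp φ ψ ih1 ih2 =>
    simp only [qrank, max_le_iff] at hφ
    exact imp_congr (ih1 hφ.1 h) (ih2 hφ.2 h)
  | all φ ih =>
    obtain ⟨m, rfl⟩ : ∃ m, k = m + 1 := ⟨k - 1, by simp only [qrank] at hφ; omega⟩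
    have hφ : qrank φ ≤ m := by simpa only [qrank, Nat.add_le_add_iff_right] using hφ
    constructor
    · intro h1 w'
      obtain ⟨w, hw⟩ := h.2.2 w' trivial
      rw [← insert_pairs_snoc] at hw
      exact (ih hφ hw).1 (h1 w)
    · intro h1 w
      obtain ⟨w', hw⟩ := h.2.1 w trivial
      rw [← insert_pairs_snoc] at hw
      exact (ih hφ hw).2 (h1 w')

theorem exists_conj {ι : Type*} {β : Type} {n k : ℕ} (s : Finset ι)
    (φ : ι → Language.graph.BoundedFormula β n) (hφ : ∀ i, qrank (φ i) ≤ k) :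
    ∃ ψ : Language.graph.BoundedFormula β n, qrank ψ ≤ k ∧
      ∀ (e : β → V) (xs : Fin n → V), BSat G ψ e xs ↔ ∀ i ∈ s, BSat G (φ i) e xs := by
  classical
  induction s using Finset.induction_on with
  | empty =>
    exact ⟨.imp .falsum .falsum, by simp [qrank], fun e xs => by
      simp [BSat, Language.BoundedFormula.Realize]⟩
  | insert i s _ ih =>
    obtain ⟨ψ, h1, h2⟩ := ih
    refine ⟨.imp (.imp (φ i) (.imp ψ .falsum)) .falsum, by simp [qrank, hφ i, h1],
      fun e xs => ?_⟩
    rw [Finset.forall_mem_insert, ← h2]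
    simp only [BSat, Language.BoundedFormula.Realize]
    tauto

theorem graphGame_of_bSat_iff [Finite V] {α : Type} {n k : ℕ} {e e' : α → V}
    {xs xs' : Fin n → V} (h : ∀ φ : Language.graph.BoundedFormula α n, qrank φ ≤ k →
      (BSat G φ e xs ↔ BSat G φ e' xs')) :
    GraphGame G k (pairs (Sum.elim e xs) (Sum.elim e' xs')) := by
  refine BackForth.of_invariant (fun k R => ∃ (n : ℕ) (e e' : α → V) (xs xs' : Fin n → V),
    R = pairs (Sum.elim e xs) (Sum.elim e' xs') ∧
    ∀ φ : Language.graph.BoundedFormula α n, qrank φ ≤ k →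
      (BSat G φ e xs ↔ BSat G φ e' xs')) ?_ ?_ ?_ ⟨n, e, e', xs, xs', rfl, h⟩
  · rintro k _ ⟨n, e, e', xs, xs', rfl, h⟩
    exact ⟨n, e', e, xs', xs, swap_pairs _ _, fun φ hφ => (h φ hφ).symm⟩
  · rintro k _ ⟨n, e, e', xs, xs', rfl, h⟩ _ ⟨i, rfl⟩ _ ⟨j, rfl⟩
    exact ⟨h (.equal (.var i) (.var j)) (Nat.zero_le _),
      h (.rel Language.adj ![.var i, .var j]) (Nat.zero_le _)⟩
  · rintro k _ ⟨n, e, e', xs, xs', rfl, h⟩ w -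
    by_contra! hcon
    -- If `w` has no good answer, each `w'` is refuted by a formula. As `V` is finite, their
    -- conjunction `ψ` is a formula, and `∃ ψ` has rank at most `k + 1` and distinguishes the
    -- tuples.
    have hdist : ∀ w', ∃ φ : Language.graph.BoundedFormula α (n + 1), qrank φ ≤ k ∧
        BSat G φ e (Fin.snoc xs w) ∧ ¬ BSat G φ e' (Fin.snoc xs' w') := by
      intro w'
      by_contra! h1
      refine hcon w' (n + 1) e e' (Fin.snoc xs w) (Fin.snoc xs' w')
        (insert_pairs_snoc ..).symm |>.elim fun φ hφ => ?_
      obtain ⟨hφ, h2⟩ := hφ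
      by_cases h3 : BSat G φ e (Fin.snoc xs w)
      · rcases h2 with h2 | h2
        · exact h2.2 (h1 φ hφ h3)
        · exact h2.1 h3
      · rcases h2 with h2 | h2
        · exact h3 h2.1
        · exact h1 (.imp φ .falsum) (by simpa [qrank] using hφ) h3 h2.2
    choose φ hφ h1 h2 using hdist
    cases nonempty_fintype V
    obtain ⟨ψ, hψ, h3⟩ := exists_conj (G := G) Finset.univ φ hφ
    have h4 := h (.imp (.all (.imp ψ .falsum)) .falsum) (by simpa [qrank] using hψ)
    refine h4.1 (fun h5 => h5 w ((h3 _ _).2 fun w' _ => h1 w')) fun w' h5 => ?_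
    exact h2 w' ((h3 _ _).1 h5 w' (Finset.mem_univ _))

/-- Since `S` is finite, a single parameter tuple can list all of it, which places `diag S` in the
position. -/
theorem graphGame_of_rankType_eq [Finite V] {k d : ℕ} {S : Set V} {u u' : Fin d → V}
    (h : rankType G k S u = rankType G k S u') : GraphGame G k (pairs u u' ∪ diag S) := by
  obtain ⟨L, v, -, hv⟩ := S.toFinite.fin_param
  have h1 : GraphGame G k (pairs (Sum.elim (Sum.elim u v) (default : Fin 0 → V))
      (Sum.elim (Sum.elim u' v) default)) := by
    refine graphGame_of_bSat_iff fun φ hφ => ?_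
    have hvS : ∀ j, v j ∈ S := fun j => hv ▸ Set.mem_range_self j
    have h2 : (⟨L, φ, v⟩ : Σ l : ℕ, Fml d l × (Fin l → V)) ∈ rankType G k S u ↔
        (⟨L, φ, v⟩ : Σ l : ℕ, Fml d l × (Fin l → V)) ∈ rankType G k S u' := by rw [h]
    exact ⟨fun h3 => (h2.1 ⟨hφ, hvS, h3⟩).2.2, fun h3 => (h2.2 ⟨hφ, hvS, h3⟩).2.2⟩
  refine GraphGame.subset ?_ h1
  rintro p (⟨i, rfl⟩ | ⟨hp, hpS⟩)
  · exact ⟨.inl (.inl i), rfl⟩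
  · rw [← hv] at hpS
    obtain ⟨j, hj⟩ := hpS
    exact ⟨.inl (.inr j), Prod.ext hj (hj.trans hp)⟩

theorem GraphGame.sat_iff {k d l : ℕ} {B : Set V} {u u' : Fin d → V}
    (h : GraphGame G k (pairs u u' ∪ diag B)) {φ : Fml d l} (hφ : qrank φ ≤ k) {v : Fin l → V}
    (hv : ∀ j, v j ∈ B) : Sat G φ u v ↔ Sat G φ u' v := by
  refine GraphGame.bSat_iff (xs := default) (xs' := default) hφ (GraphGame.subset ?_ h)
  rintro _ ⟨(i | j) | i, rfl⟩
  · exact .inl ⟨i, rfl⟩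
  · exact .inr ⟨rfl, hv j⟩
  · exact i.elim0

end Formulas

/-! ### Counting types. -/

/-- A bound on the number of classes of `n`-tuples under the game of length `k`, for
`n + k ≤ t`. -/
def tower (t k : ℕ) : ℕ :=
  Nat.rec (2 ^ (t * t) * 2 ^ (t * t)) (fun _ m => 2 ^ (t * t) * 2 ^ (t * t) * 2 ^ m) k

theorem exists_injective_fin {τ : Type} [Finite τ] {m : ℕ} (h : Nat.card τ ≤ m) :
    ∃ f : τ → Fin m, f.Injective :=
  ⟨_, (Fin.castLE_injective h).comp (Finite.equivFin τ).injective⟩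

section Counting

variable {V : Type*} (G : SimpleGraph V)

/-- The atomic type of a tuple. -/
def atomCode {n : ℕ} (x : Fin n → V) : Set (Fin n × Fin n) × Set (Fin n × Fin n) :=
  ({p | x p.1 = x p.2}, {p | G.Adj (x p.1) (x p.2)})

theorem graphAtoms_of_atomCode_eq {n : ℕ} {x x' : Fin n → V}
    (h : atomCode G x = atomCode G x') : GraphAtoms G (pairs x x') := by
  rintro _ ⟨i, rfl⟩ _ ⟨j, rfl⟩
  obtain ⟨h1, h2⟩ := Prod.ext_iff.1 h
  exact ⟨Set.ext_iff.1 h1 (i, j), Set.ext_iff.1 h2 (i, j)⟩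

/-- A class for `k + 1` rounds consists of the atomic type and the set of classes of one-point
extensions for `k` rounds. Trading a round for a coordinate keeps `n + k` at most `t`, so one bound
on atomic types serves throughout. -/
theorem exists_classifier (t k : ℕ) : ∀ n, n + k ≤ t → ∃ f : (Fin n → V) → Fin (tower t k),
    ∀ x x', f x = f x' → GraphGame G k (pairs x x') := by
  have hpow : ∀ n ≤ t, 2 ^ (n * n) ≤ 2 ^ (t * t) := fun n hn =>
    Nat.pow_le_pow_right two_pos (Nat.mul_le_mul hn hn)
  induction k with
  | zero =>
    intro n hn
    obtain ⟨g, hg⟩ := exists_injective_fin (m := tower t 0)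
      (τ := Set (Fin n × Fin n) × Set (Fin n × Fin n)) (by
        have := hpow n hn
        simpa [Nat.card_eq_fintype_card, tower] using Nat.mul_le_mul this this)
    exact ⟨fun x => g (atomCode G x), fun x x' h => graphAtoms_of_atomCode_eq G (hg h)⟩
  | succ k ih =>
    intro n hn
    obtain ⟨f, hf⟩ := ih (n + 1) (by omega)
    obtain ⟨g, hg⟩ := exists_injective_fin (m := tower t (k + 1))
      (τ := (Set (Fin n × Fin n) × Set (Fin n × Fin n)) × Set (Fin (tower t k))) (by
        have := hpow n (by omega)
        simpa [Nat.card_eq_fintype_card, tower] using Nat.mul_le_mul this this)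
    refine ⟨fun x => g (atomCode G x, Set.range fun w => f (Fin.snoc x w)), fun x x' h => ?_⟩
    obtain ⟨h1, h2⟩ := Prod.ext_iff.1 (hg h)
    have hsnoc : ∀ w w', f (Fin.snoc x w) = f (Fin.snoc x' w') →
        GraphGame G k (insert (w, w') (pairs x x')) := by
      intro w w' hw
      refine GraphGame.subset ?_ (hf _ _ hw)
      rintro _ (rfl | ⟨i, rfl⟩)
      · exact ⟨Fin.last n, by simp⟩
      · exact ⟨i.castSucc, by simp⟩
    refine ⟨graphAtoms_of_atomCode_eq G h1, fun w _ => ?_, fun w' _ => ?_⟩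
    · obtain ⟨w', hw⟩ : f (Fin.snoc x w) ∈ Set.range fun w => f (Fin.snoc x' w) :=
        h2.subset (Set.mem_range_self w)
      exact ⟨w', hsnoc w w' hw.symm⟩
    · obtain ⟨w, hw⟩ : f (Fin.snoc x' w') ∈ Set.range fun w => f (Fin.snoc x w) :=
        h2.symm.subset (Set.mem_range_self w')
      exact ⟨w, hsnoc w w' hw⟩

theorem encard_typeSet_le {d l q s : ℕ} {φ : Fml d l} (hφ : qrank φ ≤ q) {A B S : Set V}
    (hS : S.encard ≤ s) (hsep : Separated G (sepRadius q d) A B S) :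
    (typeSet G φ A B).encard ≤ tower (d + s + sepRank q d) (sepRank q d) := by
  obtain ⟨L, v, hinj, hv⟩ := (Set.finite_of_encard_le_coe hS).fin_param
  have hL : L ≤ s := by
    have h : (L : ℕ∞) ≤ s := by
      rwa [← hv, ← Set.image_univ, hinj.encard_image, Set.encard_univ, ENat.card_eq_coe_fintype_card,
        Fintype.card_fin] at hS
    exact_mod_cast h
  obtain ⟨f, hf⟩ := exists_classifier G (d + s + sepRank q d) (sepRank q d) (d + L) (by omega)
  have htype : ∀ u u' : Fin d → V, (∀ i, u i ∈ A) → (∀ i, u' i ∈ A) →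
      f (Fin.append u v) = f (Fin.append u' v) → phiType G φ B u = phiType G φ B u' := by
    intro u u' hu hu' h
    have hgame : GraphGame G (sepRank q d) (pairs u u' ∪ diag S) := by
      refine GraphGame.subset ?_ (hf _ _ h)
      rintro ⟨p, p'⟩ (⟨i, hi⟩ | ⟨hp, hpS⟩)
      · exact ⟨Fin.castAdd L i, by simpa using hi⟩
      · rw [← hv] at hpS
        obtain ⟨j, hj⟩ := hpS
        obtain rfl : p = p' := hp
        exact ⟨Fin.natAdd d j, by simpa using hj⟩
    have hgame := hgame.of_separated hsep hu hu'
    exact Set.ext fun y => and_congr_right fun hy => hgame.sat_iff hφ hy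
  choose u hu hφu using fun τ (hτ : τ ∈ typeSet G φ A B) => hτ
  have hle : (typeSet G φ A B).encard ≤
      (Set.univ : Set (Fin (tower (d + s + sepRank q d) (sepRank q d)))).encard := by
    rw [Set.encard_univ]
    refine ENat.card_le_card_of_injective
      (f := fun τ : typeSet G φ A B => f (Fin.append (u τ τ.2) v)) fun τ τ' h => ?_
    refine Subtype.ext ?_
    rw [← hφu τ τ.2, ← hφu τ' τ'.2]
    exact htype _ _ (hu τ τ.2) (hu τ' τ'.2) h
  simpa using hle

end Counting

/-! ### Computability of the bounds. -/

theorem qrank_le_bdCode {d l n : ℕ} (φ : Language.graph.BoundedFormula (Fin d ⊕ Fin l) n) :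
    qrank φ ≤ bdCode φ := by
  induction φ with
  | falsum => exact Nat.zero_le _
  | equal _ _ => exact Nat.zero_le _
  | rel _ _ => exact Nat.zero_le _
  | imp φ ψ ih1 ih2 =>
    have h1 := Nat.left_le_pair (bdCode φ) (bdCode ψ)
    have h2 := Nat.right_le_pair (bdCode φ) (bdCode ψ)
    simp only [qrank, bdCode]
    omega
  | all φ ih =>
    simp only [qrank, bdCode]
    omega

theorem qrank_le_code {d l : ℕ} (φ : Fml d l) : qrank φ ≤ code φ :=
  (qrank_le_bdCode φ).trans ((Nat.right_le_pair _ _).trans (Nat.right_le_pair _ _))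

theorem unpair_code {d l : ℕ} (φ : Fml d l) : (code φ).unpair.1 = d := by
  simp [code]

theorem primrec_pow : Primrec₂ ((· ^ ·) : ℕ → ℕ → ℕ) :=
  Primrec₂.unpaired'.1 Nat.Primrec.pow

theorem primrec_tower : Primrec₂ tower := by
  have h1 : Primrec fun t : ℕ => 2 ^ (t * t) * 2 ^ (t * t) := by
    have h : Primrec fun t : ℕ => 2 ^ (t * t) :=
      primrec_pow.comp (Primrec.const 2) (Primrec.nat_mul.comp .id .id)
    exact Primrec.nat_mul.comp h h
  have h2 : Primrec₂ fun (t : ℕ) (p : ℕ × ℕ) => 2 ^ (t * t) * 2 ^ (t * t) * 2 ^ p.2 :=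
    Primrec.nat_mul.comp (h1.comp .fst)
      (primrec_pow.comp (Primrec.const 2) (Primrec.snd.comp .snd))
  exact Primrec.nat_rec h1 h2

theorem primrec_gameLength :
    Primrec₂ fun q d : ℕ => q * (d + q) :=
  Primrec.nat_mul.comp .fst (Primrec.nat_add.comp .snd .fst)

theorem primrec_radius : Primrec₂ fun q d : ℕ => 3 * (q * (d + q) + 1) :=
  Primrec.nat_mul.comp (.const 3) (Primrec.succ.comp primrec_gameLength)

theorem primrec_sepRank : Primrec₂ sepRank :=
  Primrec.nat_add.comp primrec_gameLength (primrec_pow.comp primrec_radius .fst)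

theorem primrec_sepRadius : Primrec₂ sepRadius :=
  primrec_pow.comp (Primrec.nat_mul.comp (.const 2) primrec_radius) .fst

end GraphTypes

theorem mainTheorem7 :
    -- the rank-`q` type over `B` is determined by the rank-`p` type over `S`
    (∃ p r : ℕ → ℕ → ℕ, Computable₂ p ∧ Computable₂ r ∧
      ∀ (q d : ℕ) (V : Type*) [Finite V] (G : SimpleGraph V) (A B S : Set V),
        GraphTypes.Separated G (r q d) A B S →
        ∀ u u' : Fin d → V, (∀ i, u i ∈ A) → (∀ i, u' i ∈ A) →
          GraphTypes.rankType G (p q d) S u = GraphTypes.rankType G (p q d) S u' →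
          GraphTypes.rankType G q B u = GraphTypes.rankType G q B u') ∧
    -- the number of `φ`-types of tuples from `A` over `B` is bounded
    (∃ (r : ℕ → ℕ) (T : ℕ → ℕ → ℕ), Computable r ∧ Computable₂ T ∧
      ∀ (d l : ℕ) (φ : GraphTypes.Fml d l) (s : ℕ)
        (V : Type*) [Finite V] (G : SimpleGraph V) (A B S : Set V),
        S.encard ≤ (s : ℕ∞) →
        GraphTypes.Separated G (r (GraphTypes.code φ)) A B S →
        (GraphTypes.typeSet G φ A B).encard ≤ (T (GraphTypes.code φ) s : ℕ∞)) := by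
  open GraphTypes in
  constructor
  · refine ⟨sepRank, sepRadius, primrec_sepRank.to_comp, primrec_sepRadius.to_comp, ?_⟩
    intro q d V _ G A B S hsep u u' hu hu' h
    have hgame := (graphGame_of_rankType_eq h).of_separated hsep hu hu'
    exact Set.ext fun θ => and_congr_right fun hθ => and_congr_right fun hv =>
      hgame.sat_iff hθ hv
  · have hdim : Primrec fun c : ℕ => c.unpair.1 := Primrec.fst.comp Primrec.unpair
    have hrank : Primrec fun c : ℕ => sepRank c c.unpair.1 := primrec_sepRank.comp .id hdim
    have hT : Primrec₂ fun c s : ℕ =>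
        tower (c.unpair.1 + s + sepRank c c.unpair.1) (sepRank c c.unpair.1) :=
      primrec_tower.comp (Primrec.nat_add.comp (Primrec.nat_add.comp (hdim.comp .fst) .snd)
        (hrank.comp .fst)) (hrank.comp .fst)
    -- The code itself serves as a bound on the quantifier rank, and its first component is `d`, so
    -- nothing needs to be decoded further.
    refine ⟨fun c => sepRadius c c.unpair.1, _, (primrec_sepRadius.comp .id hdim).to_comp,
      hT.to_comp, ?_⟩
    intro d l φ s V _ G A B S hS hsep
    simp only [unpair_code] at hsep ⊢
    exact encard_typeSet_le G (qrank_le_code φ) hS hsep
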